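/- A Hadamard matrix of order $d$ is a $d\times d$ matrix $H$ with entries $\pm1$ and $HH^\top=dI$; a weighing matrix of order $d$ and weight $k$ is a $d\times d$ matrix $W$ with entries in $\{0,1,-1\}$ and $WW^\top=kI$. Two Hadamard matrices $H_1,H_2$ of order $d$ are quasi-unbiased for parameters $(d,l,a)$ if $\frac1{\sqrt a}H_1H_2^\top$ is a weighing matrix of weight $l$; Hadamard matrices $H_1,\dots,H_f$ of order $d$ are mutually quasi-unbiased for parameters $(d,l,a)$ if $H_i$ and $H_j$ are quasi-unbiased for $(d,l,a)$ whenever $i\ne j$. **Theorem.** For each triple $(d,l,a)$ below, the maximum number $f$ of mutually quasi-unbiased Hadamard matrices for parameters $(d,l,a)$ exists and satisfies all the bounds listed in its row (a dash means that no bound is listed): $$\begin{array}{|c||c|c|c|c|}\hline (d,l,a) & \text{previously known} & \text{LP, degree }4 & \text{LP, degree }6 & \text{SDP}\\ \hline (16,4,64) & f\le 35 & - & f\le 15 & f\le 15\\ (24,4,144) & f\le 85 & - & f\le 27 & f\le 25\\ (24,9,64) & f\le 85 & f\le 208 & - & f\le 95\\ (32,4,256) & f\le 155 & - & f\le 63 &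 f\le 47\\ (36,9,144) & f\le 199 & - & f\le 80 & f\le 79\\ (40,4,400) & f\le 247 & - & - & f\le 101\\ (40,25,64) & f\le 28 & f\le 30 & - & f\le 30\\ (48,4,576) & f\le 361 & - & - & f\le 276\\ (48,9,256) & f\le 361 & - & f\le 105 & f\le 104\\ (48,16,144) & f\le 361 & - & - & f\le 316\\ (48,36,64) & f\le 28 & f\le 30 & - & f\le 30\\ \hline \end{array}$$ (The column headings only record by which method a bound was obtained.) -/

import Mathlib

open scoped Matrix

/-- A weighing matrix of order `d` and weight `k`: a `d × d` matrix with entries in `{0, 1, -1}`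
such that `W * Wᵀ = k I`. -/
def IsWeighing {d : ℕ} (W : Matrix (Fin d) (Fin d) ℝ) (k : ℕ) : Prop :=
  (∀ i j, W i j = 0 ∨ W i j = 1 ∨ W i j = -1) ∧
    W * Wᵀ = (k : ℝ) • (1 : Matrix (Fin d) (Fin d) ℝ)

/-- Two matrices of order `d` are quasi-unbiased for parameters `(d, l, a)` if
`(1 / √a) H₁ H₂ᵀ` is a weighing matrix of weight `l`. -/
def IsQuasiUnbiased (d l a : ℕ) (H₁ H₂ : Matrix (Fin d) (Fin d) ℝ) : Prop :=
  IsWeighing ((1 / Real.sqrt (a : ℝ)) • (H₁ * H₂ᵀ)) l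

/-- `H₁, …, H_f` are mutually quasi-unbiased Hadamard matrices for parameters `(d, l, a)`:
each is a Hadamard matrix of order `d` (over `ℝ`, `Matrix.IsHadamard` means entries `±1` and
orthogonal rows), and any two distinct ones are quasi-unbiased. -/
def MutuallyQuasiUnbiased (d l a : ℕ) {f : ℕ} (H : Fin f → Matrix (Fin d) (Fin d) ℝ) : Prop :=
  (∀ i, (H i).IsHadamard) ∧ ∀ i j, i ≠ j → IsQuasiUnbiased d l a (H i) (H j)

/-- `f` is the maximum number of mutually quasi-unbiased Hadamard matrices for parameters
`(d, l, a)`. -/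
def IsMaxQuasiUnbiased (d l a f : ℕ) : Prop :=
  IsGreatest {n : ℕ | ∃ H : Fin n → Matrix (Fin d) (Fin d) ℝ, MutuallyQuasiUnbiased d l a H} f

/-! Pool the rows of all the matrices into fd sign vectors. The kernel e_k(u∘v) is positive
semidefinite, and on sign vectors with k = 4 or 6 it is a polynomial g in the squared inner product
(`esymm_of_sq_eq_one`). The parameters fix how often each squared inner product occurs, so summing
over all pairs gives P + (f-1)Q ≥ 0, with P and Q depending only on (d,l,a) and g. When Q < 0 this
bounds f, and ten rows of the table follow.

For (48,4,576), Q is positive in both degrees. There d² = 4a, so every nonzero inner product between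
different matrices is ±d/2. One suitably signed row from each matrix but the first then gives f-1
vectors in ℝ^d pairwise at 60°, which are linearly independent, so f ≤ d+1. -/

open Finset in
/-- The kernel `(u, v) ↦ e_k(u ∘ v)`, with `e_k` the elementary symmetric polynomial, is positive. -/
theorem sum_sum_esymm_mul_nonneg {ι σ : Type*} [Fintype ι] [Fintype σ] (k : ℕ) (u : ι → σ → ℝ) :
    0 ≤ ∑ x, ∑ y, ∑ t ∈ powersetCard k univ, ∏ i ∈ t, u x i * u y i := by
  have h : ∑ x, ∑ y, ∑ t ∈ powersetCard k univ, ∏ i ∈ t, u x i * u y i =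
      ∑ t ∈ powersetCard k univ, (∑ x, ∏ i ∈ t, u x i) ^ 2 := by
    simp_rw [Finset.prod_mul_distrib, sq, Finset.sum_mul_sum]
    exact (Finset.sum_congr rfl fun x _ => Finset.sum_comm).trans Finset.sum_comm
  rw [h]
  exact Finset.sum_nonneg fun t _ => sq_nonneg _

open Finset in
/-- Newton's identities, evaluated at a vector. -/
theorem newton_identity {σ : Type*} [Fintype σ] [DecidableEq σ] (k : ℕ) (w : σ → ℝ) :
    (k : ℝ) * ∑ t ∈ powersetCard k univ, ∏ i ∈ t, w i = (-1) ^ (k + 1) *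
      ∑ a ∈ antidiagonal k with a.1 < k,
        (-1) ^ a.1 * (∑ t ∈ powersetCard a.1 univ, ∏ i ∈ t, w i) * ∑ i, w i ^ a.2 := by
  have h := congrArg (MvPolynomial.aeval w) (MvPolynomial.mul_esymm_eq_sum σ ℝ k)
  simpa [MvPolynomial.esymm, MvPolynomial.psum, map_sum, map_prod] using h

/-! ### Elementary symmetric polynomials of sign vectors -/

section SignVectors

open Finset

variable {σ : Type*} [Fintype σ] {w : σ → ℝ}

theorem sum_pow_of_sq_eq_one (hw : ∀ i, w i ^ 2 = 1) :
    ∑ i, w i ^ 2 = Fintype.card σ ∧ ∑ i, w i ^ 3 = ∑ i, w i ∧ ∑ i, w i ^ 4 = Fintype.card σ ∧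
      ∑ i, w i ^ 5 = ∑ i, w i ∧ ∑ i, w i ^ 6 = Fintype.card σ := by
  have h3 : ∀ i, w i ^ 3 = w i := fun i => by rw [pow_succ, hw, one_mul]
  have h4 : ∀ i, w i ^ 4 = 1 := fun i => by rw [pow_succ, h3, ← sq, hw]
  have h5 : ∀ i, w i ^ 5 = w i := fun i => by rw [pow_succ, h4, one_mul]
  have h6 : ∀ i, w i ^ 6 = 1 := fun i => by rw [pow_succ, h5, ← sq, hw]
  simp [hw, h3, h4, h5, h6]

/-- Even power sums equal the dimension and odd ones equal the first, so Newton's recursion leaves a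
polynomial in these two quantities. -/
theorem esymm_of_sq_eq_one [DecidableEq σ] (hw : ∀ i, w i ^ 2 = 1) :
    24 * ∑ t ∈ powersetCard 4 univ, ∏ i ∈ t, w i = (∑ i, w i) ^ 4
        - (6 * (Fintype.card σ : ℝ) - 8) * (∑ i, w i) ^ 2
        + 3 * (Fintype.card σ : ℝ) ^ 2 - 6 * Fintype.card σ ∧
    720 * ∑ t ∈ powersetCard 6 univ, ∏ i ∈ t, w i = (∑ i, w i) ^ 6
        - (15 * (Fintype.card σ : ℝ) - 40) * (∑ i, w i) ^ 4
        + (45 * (Fintype.card σ : ℝ) ^ 2 - 210 * Fintype.card σ + 184) * (∑ i, w i) ^ 2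
        - 15 * (Fintype.card σ : ℝ) ^ 3 + 90 * (Fintype.card σ : ℝ) ^ 2
        - 120 * Fintype.card σ := by
  obtain ⟨p2, p3, p4, p5, p6⟩ := sum_pow_of_sq_eq_one hw
  have e0 : ∑ t ∈ powersetCard 0 univ, ∏ i ∈ t, w i = 1 := by simp
  have e1 := newton_identity 1 w
  have e2 := newton_identity 2 w
  have e3 := newton_identity 3 w
  have e4 := newton_identity 4 w
  have e5 := newton_identity 5 w
  have e6 := newton_identity 6 w
  simp only [Finset.sum_filter, Finset.Nat.sum_antidiagonal_eq_sum_range_succ_mk,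
    Finset.sum_range_succ, Finset.sum_range_zero, e0, p2, p3, p4, p5, p6] at e1 e2 e3 e4 e5 e6
  norm_num [e0, p2, p3, p4, p5, p6] at e1 e2 e3 e4 e5 e6
  generalize (∑ t ∈ powersetCard 1 univ, ∏ i ∈ t, w i) = E1 at *
  generalize (∑ t ∈ powersetCard 2 univ, ∏ i ∈ t, w i) = E2 at *
  generalize (∑ t ∈ powersetCard 3 univ, ∏ i ∈ t, w i) = E3 at *
  generalize (∑ t ∈ powersetCard 4 univ, ∏ i ∈ t, w i) = E4 at *
  generalize (∑ t ∈ powersetCard 5 univ, ∏ i ∈ t, w i) = E5 at *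
  generalize (∑ t ∈ powersetCard 6 univ, ∏ i ∈ t, w i) = E6 at *
  generalize (∑ i, w i) = s at *
  generalize (Fintype.card σ : ℝ) = d at *
  obtain rfl : E2 = (s ^ 2 - d) / 2 := by linear_combination e2 / 2 + s / 2 * e1
  obtain rfl : E3 = (s ^ 3 - (3 * d - 2) * s) / 6 := by linear_combination e3 / 3 - d / 3 * e1
  obtain rfl : E4 = (s ^ 4 - (6 * d - 8) * s ^ 2 + 3 * d ^ 2 - 6 * d) / 24 := by
    linear_combination e4 / 4 + s / 4 * e1
  refine ⟨by ring, ?_⟩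
  linear_combination 120 * e6 + 24 * s * e5 + (120 * s - 24 * s * d) * e1

end SignVectors

/-! ### Equiangular vectors at 60° -/

/-- Vectors at angle `60°` to one another are linearly independent. -/
theorem linearIndependent_of_dotProduct_eq {ι σ : Type*} [Fintype ι] [Fintype σ]
    {v : ι → σ → ℝ} {m : ℝ} (hm : 0 < m) (hdiag : ∀ i, v i ⬝ᵥ v i = 2 * m)
    (hoff : ∀ i j, i ≠ j → v i ⬝ᵥ v j = m) : LinearIndependent ℝ v := by
  classical
  rw [Fintype.linearIndependent_iff]
  intro c hc
  have hgram : ∀ i j, v i ⬝ᵥ v j = m + if i = j then m else 0 := fun i j => by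
    split_ifs with h
    · rw [h, hdiag, two_mul]
    · rw [hoff i j h, add_zero]
  -- The Gram matrix is m(I + J), with J the all-ones matrix, hence positive definite.
  have h : (∑ i, c i • v i) ⬝ᵥ (∑ j, c j • v j) = m * (∑ i, c i) ^ 2 + m * ∑ i, c i ^ 2 := by
    simp_rw [sum_dotProduct, dotProduct_sum, smul_dotProduct, dotProduct_smul, hgram,
      smul_eq_mul, mul_add, mul_ite, mul_zero, Finset.sum_add_distrib, Finset.sum_ite_eq,
      Finset.mem_univ, if_true, sq, Finset.sum_mul_sum, Finset.mul_sum]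
    congr 1
    · exact Finset.sum_congr rfl fun i _ => Finset.sum_congr rfl fun j _ => by ring
    · exact Finset.sum_congr rfl fun i _ => by ring
  rw [hc, zero_dotProduct] at h
  have hsum : ∑ i, c i ^ 2 = 0 := by
    have h1 : 0 ≤ ∑ i, c i ^ 2 := Finset.sum_nonneg fun i _ => sq_nonneg _
    nlinarith [mul_nonneg hm.le h1, mul_nonneg hm.le (sq_nonneg (∑ i, c i))]
  intro i
  exact pow_eq_zero_iff two_ne_zero |>.1
    ((Finset.sum_eq_zero_iff_of_nonneg fun i _ => sq_nonneg _).1 hsum i (Finset.mem_univ i))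

/-! ### Inner product distributions of rows -/

theorem Matrix.IsHadamard.sq_apply_eq_one {n : Type*} [Fintype n] [DecidableEq n]
    {H : Matrix n n ℝ} (hH : H.IsHadamard) (i j : n) : H i j ^ 2 = 1 := by
  have h := (Unitary.mem_iff.1 (hH.apply_mem i j)).1
  simpa [sq] using h

theorem Matrix.IsHadamard.mul_transpose_eq {d : ℕ} {H : Matrix (Fin d) (Fin d) ℝ}
    (hH : H.IsHadamard) : H * Hᵀ = (d : ℝ) • (1 : Matrix (Fin d) (Fin d) ℝ) := by
  simpa [Matrix.conjTranspose_eq_transpose_of_trivial] using hH.mul_conjTranspose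

theorem Matrix.IsHadamard.transpose_mul_eq {d : ℕ} {H : Matrix (Fin d) (Fin d) ℝ}
    (hH : H.IsHadamard) : Hᵀ * H = (d : ℝ) • (1 : Matrix (Fin d) (Fin d) ℝ) := by
  simpa [Matrix.conjTranspose_eq_transpose_of_trivial] using hH.conjTranspose_mul

namespace IsQuasiUnbiased

variable {d l a : ℕ} {H₁ H₂ : Matrix (Fin d) (Fin d) ℝ}

theorem sq_mul_transpose_apply (h : IsQuasiUnbiased d l a H₁ H₂) (ha : 0 < a) (i j : Fin d) :
    ((H₁ * H₂ᵀ) i j) ^ 2 = 0 ∨ ((H₁ * H₂ᵀ) i j) ^ 2 = a := by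
  have ha' : (0 : ℝ) < a := Nat.cast_pos.2 ha
  have hs : (1 / Real.sqrt a * (H₁ * H₂ᵀ) i j) ^ 2 * a = (H₁ * H₂ᵀ) i j ^ 2 := by
    rw [mul_pow, div_pow, Real.sq_sqrt ha'.le]
    field_simp
  rcases h.1 i j with h0 | h0 | h0 <;> rw [Matrix.smul_apply, smul_eq_mul] at h0 <;>
    rw [h0] at hs <;> norm_num at hs
  · exact Or.inl (by rw [← hs])
  · exact Or.inr hs.symm
  · exact Or.inr hs.symm

theorem sum_sq_mul_transpose_apply (h : IsQuasiUnbiased d l a H₁ H₂) (ha : 0 < a) (i : Fin d) :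
    ∑ j, ((H₁ * H₂ᵀ) i j) ^ 2 = a * l := by
  have ha' : (0 : ℝ) < a := Nat.cast_pos.2 ha
  have hW := congrFun (congrFun h.2 i) i
  rw [Matrix.mul_apply] at hW
  simp only [Matrix.transpose_apply, Matrix.smul_apply, smul_eq_mul, Matrix.one_apply_eq,
    mul_one] at hW
  rw [← hW, Finset.mul_sum]
  refine Finset.sum_congr rfl fun j _ => ?_
  have hne : Real.sqrt a ≠ 0 := (Real.sqrt_pos.2 ha').ne'
  field_simp
  rw [Real.sq_sqrt ha'.le]

/-- A function of the squared inner product with the rows of `H₂` has a sum determined by the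
parameters. -/
theorem sum_comp_sq (h : IsQuasiUnbiased d l a H₁ H₂) (ha : 0 < a) (g : ℝ → ℝ) (i : Fin d) :
    ∑ j, g (((H₁ * H₂ᵀ) i j) ^ 2) = d * g 0 + l * (g a - g 0) := by
  have ha' : (a : ℝ) ≠ 0 := (Nat.cast_pos.2 ha).ne'
  -- Only the values 0 and a occur, so g may be replaced by its linear interpolant there.
  have hg : ∀ j, g (((H₁ * H₂ᵀ) i j) ^ 2) =
      g 0 + ((H₁ * H₂ᵀ) i j) ^ 2 * ((g a - g 0) / a) := fun j => by
    rcases h.sq_mul_transpose_apply ha i j with h0 | h0 <;> rw [h0]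
    · ring
    · field_simp
      ring
  simp_rw [hg]
  rw [Finset.sum_add_distrib, ← Finset.sum_mul, h.sum_sq_mul_transpose_apply ha]
  simp
  field_simp

end IsQuasiUnbiased

theorem Matrix.IsHadamard.sum_comp_sq {d : ℕ} {H : Matrix (Fin d) (Fin d) ℝ}
    (hH : H.IsHadamard) (g : ℝ → ℝ) (i : Fin d) :
    ∑ j, g (((H * Hᵀ) i j) ^ 2) = g ((d : ℝ) ^ 2) + (d - 1) * g 0 := by
  have hg : ∀ j, g (((H * Hᵀ) i j) ^ 2) =
      g 0 + if i = j then g ((d : ℝ) ^ 2) - g 0 else 0 := fun j => by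
    rw [hH.mul_transpose_eq, Matrix.smul_apply, Matrix.one_apply]
    split_ifs <;> simp
  simp_rw [hg]
  rw [Finset.sum_add_distrib, Finset.sum_ite_eq]
  simp
  ring

/-! ### Linear programming inequalities -/

namespace MutuallyQuasiUnbiased

variable {d l a f : ℕ} {H : Fin f → Matrix (Fin d) (Fin d) ℝ}

theorem sum_comp_sq (hH : MutuallyQuasiUnbiased d l a H) (ha : 0 < a) (g : ℝ → ℝ) :
    ∑ x : Fin f × Fin d, ∑ y : Fin f × Fin d, g ((∑ k, H x.1 x.2 k * H y.1 y.2 k) ^ 2) =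
      f * d * (g ((d : ℝ) ^ 2) + (d - 1) * g 0 + (f - 1) * (d * g 0 + l * (g a - g 0))) := by
  have hrow : ∀ i i' r, ∑ r', g ((∑ k, H i r k * H i' r' k) ^ 2) =
      (d * g 0 + l * (g a - g 0)) + if i = i' then
        g ((d : ℝ) ^ 2) + (d - 1) * g 0 - (d * g 0 + l * (g a - g 0)) else 0 := by
    intro i i' r
    split_ifs with h
    · subst h
      rw [add_sub_cancel, ← (hH.1 i).sum_comp_sq g r]
      rfl
    · rw [add_zero, ← (hH.2 i i' h).sum_comp_sq ha g r]
      rfl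
  simp_rw [Fintype.sum_prod_type, hrow, Finset.sum_add_distrib, Finset.sum_ite_eq]
  simp
  ring

theorem degree_four_inequality (hH : MutuallyQuasiUnbiased d l a H) (ha : 0 < a) (g : ℝ → ℝ)
    (hg : ∀ q, g q = q ^ 2 - (6 * d - 8) * q + 3 * (d : ℝ) ^ 2 - 6 * d) :
    0 ≤ f * d * (g ((d : ℝ) ^ 2) + (d - 1) * g 0 + (f - 1) * (d * g 0 + l * (g a - g 0))) := by
  rw [← hH.sum_comp_sq ha]
  have key := sum_sum_esymm_mul_nonneg 4 fun x : Fin f × Fin d => H x.1 x.2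
  -- The factor 4! clears the denominators of e_4.
  refine (mul_nonneg (by norm_num : (0 : ℝ) ≤ 24) key).trans_eq ?_
  rw [Finset.mul_sum]
  refine Finset.sum_congr rfl fun x _ => ?_
  rw [Finset.mul_sum]
  refine Finset.sum_congr rfl fun y _ => ?_
  have hw : ∀ k, (H x.1 x.2 k * H y.1 y.2 k) ^ 2 = 1 := fun k => by
    rw [mul_pow, (hH.1 _).sq_apply_eq_one, (hH.1 _).sq_apply_eq_one, one_mul]
  rw [(esymm_of_sq_eq_one hw).1, hg, Fintype.card_fin]
  ring

theorem degree_six_inequality (hH : MutuallyQuasiUnbiased d l a H) (ha : 0 < a) (g : ℝ → ℝ)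
    (hg : ∀ q, g q = q ^ 3 - (15 * d - 40) * q ^ 2 + (45 * (d : ℝ) ^ 2 - 210 * d + 184) * q
      - 15 * (d : ℝ) ^ 3 + 90 * (d : ℝ) ^ 2 - 120 * d) :
    0 ≤ f * d * (g ((d : ℝ) ^ 2) + (d - 1) * g 0 + (f - 1) * (d * g 0 + l * (g a - g 0))) := by
  rw [← hH.sum_comp_sq ha]
  have key := sum_sum_esymm_mul_nonneg 6 fun x : Fin f × Fin d => H x.1 x.2
  refine (mul_nonneg (by norm_num : (0 : ℝ) ≤ 720) key).trans_eq ?_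
  rw [Finset.mul_sum]
  refine Finset.sum_congr rfl fun x _ => ?_
  rw [Finset.mul_sum]
  refine Finset.sum_congr rfl fun y _ => ?_
  have hw : ∀ k, (H x.1 x.2 k * H y.1 y.2 k) ^ 2 = 1 := fun k => by
    rw [mul_pow, (hH.1 _).sq_apply_eq_one, (hH.1 _).sq_apply_eq_one, one_mul]
  rw [(esymm_of_sq_eq_one hw).2, hg, Fintype.card_fin]
  ring

/-! ### Weight four -/

/-- If `l = 4`, a row of `H i` and a column index single out, up to sign, a row of `H j` at
angle `60°` to it that has the opposite entry in that column. -/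
theorem exists_row_of_weight_four (hH : MutuallyQuasiUnbiased d 4 a H) (ha : 0 < a)
    (had : 4 * a = d ^ 2) {i j : Fin f} (hij : i ≠ j) (r c : Fin d) :
    ∃ (r' : Fin d) (ε : ℝ), ε ^ 2 = 1 ∧ ε * (H i * (H j)ᵀ) r r' = d / 2 ∧
      ε * (H j r' c * H i r c) = -1 := by
  have had' : (4 : ℝ) * a = (d : ℝ) ^ 2 := by exact_mod_cast had
  have hd : (0 : ℝ) < d := Nat.cast_pos.2 (Fin.pos r)
  set p : Fin d → ℝ := fun r' => (H i * (H j)ᵀ) r r' with hp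
  have hpsq : ∀ r', p r' ^ 2 = 0 ∨ p r' ^ 2 = a := (hH.2 i j hij).sq_mul_transpose_apply ha r
  have hsgn : ∀ r', (H j r' c * H i r c) ^ 2 = 1 := fun r' => by
    rw [mul_pow, (hH.1 _).sq_apply_eq_one, (hH.1 _).sq_apply_eq_one, one_mul]
  -- Expand row r of `H i` in the orthogonal rows of `H j` and read off column c.
  have hsum : ∑ r', p r' * (H j r' c * H i r c) = d := by
    have h : (H i * (H j)ᵀ * H j) r c = d * H i r c := by
      rw [Matrix.mul_assoc, (hH.1 j).transpose_mul_eq]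
      simp
    rw [Matrix.mul_apply] at h
    simp_rw [← mul_assoc]
    rw [← Finset.sum_mul, h, mul_assoc, ← sq, (hH.1 i).sq_apply_eq_one, mul_one]
  have hsumsq : ∑ r', (p r' * (H j r' c * H i r c)) ^ 2 = (d : ℝ) ^ 2 := by
    simp_rw [mul_pow (p _), hsgn, mul_one]
    rw [hp, (hH.2 i j hij).sum_sq_mul_transpose_apply ha r, ← had']
    push_cast
    ring
  -- The terms lie in {0, ±d/2}. If none were -d/2, each would satisfy t² = (d/2)t, and the sum of
  -- squares would be d²/2 instead of d².
  obtain ⟨r', hr'⟩ : ∃ r', p r' * (H j r' c * H i r c) = -(d / 2) := by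
    by_contra! hne
    have hterm : ∀ r', (p r' * (H j r' c * H i r c)) ^ 2 =
        d / 2 * (p r' * (H j r' c * H i r c)) := fun r' => by
      have ht : (p r' * (H j r' c * H i r c)) ^ 2 = p r' ^ 2 := by rw [mul_pow, hsgn, mul_one]
      rcases hpsq r' with h | h
      · rw [h] at ht
        rw [pow_eq_zero_iff two_ne_zero] at ht
        rw [ht]
        ring
      · have hfac : (p r' * (H j r' c * H i r c) - d / 2) *
            (p r' * (H j r' c * H i r c) + d / 2) = 0 := by
          linear_combination ht + h + had' / 4
        rcases mul_eq_zero.1 hfac with h' | h'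
        · linear_combination (p r' * (H j r' c * H i r c)) * h'
        · exact absurd (eq_neg_of_add_eq_zero_left h') (hne r')
    rw [Finset.sum_congr rfl fun r' _ => hterm r', ← Finset.mul_sum, hsum] at hsumsq
    nlinarith
  have hpr : p r' ^ 2 = (d / 2 : ℝ) ^ 2 := by
    have := congrArg (· ^ 2) hr'
    simp only [mul_pow (p _), hsgn] at this
    linear_combination this
  refine ⟨r', p r' / (d / 2), ?_, ?_, ?_⟩
  · rw [div_pow, hpr, div_self (by positivity)]
  · change p r' / (d / 2) * p r' = d / 2
    rw [div_mul_eq_mul_div, ← sq, hpr, sq, mul_div_assoc, div_self (by positivity), mul_one]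
  · rw [div_mul_eq_mul_div, hr', neg_div, div_self (by positivity)]

theorem le_order_add_one_of_weight_four (hH : MutuallyQuasiUnbiased d 4 a H) (ha : 0 < a)
    (had : 4 * a = d ^ 2) : f ≤ d + 1 := by
  have had' : (4 : ℝ) * a = (d : ℝ) ^ 2 := by exact_mod_cast had
  have hd : 0 < d := Nat.pos_of_ne_zero fun h => by subst h; omega
  obtain _ | n := f
  · exact Nat.zero_le _
  have hdR : (0 : ℝ) < d := Nat.cast_pos.2 hd
  choose r' ε hε hx hc using fun i : Fin n =>
    hH.exists_row_of_weight_four ha had (Fin.succ_ne_zero i).symm ⟨0, hd⟩ ⟨0, hd⟩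
  set x : Fin d → ℝ := H 0 ⟨0, hd⟩ with hxdef
  have hxsq : ∀ k, x k ^ 2 = 1 := fun k => (hH.1 0).sq_apply_eq_one _ k
  let v : Fin n → Fin d → ℝ := fun i => ε i • H i.succ (r' i)
  have hvsq : ∀ i k, v i k ^ 2 = 1 := fun i k => by
    simp only [v, Pi.smul_apply, smul_eq_mul, mul_pow, hε, (hH.1 _).sq_apply_eq_one, mul_one]
  have hxv : ∀ i, x ⬝ᵥ v i = d / 2 := fun i => by
    rw [dotProduct_smul, smul_eq_mul, ← hx i]
    rfl
  have hxx : x ⬝ᵥ x = d := by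
    simp [dotProduct, ← sq, hxsq]
  have hvv : ∀ i, v i ⬝ᵥ v i = d := fun i => by
    simp [dotProduct, ← sq, hvsq]
  -- Each entry of x - v_i is 0 or 2x_k, so two such entries never have opposite signs.
  have hterm : ∀ i j k, 0 ≤ (x k - v i k) * (x k - v j k) := fun i j k => by
    rcases sq_eq_one_iff.1 (hxsq k) with h | h <;>
      rcases sq_eq_one_iff.1 (hvsq i k) with h' | h' <;>
      rcases sq_eq_one_iff.1 (hvsq j k) with h'' | h'' <;>
      rw [h, h', h''] <;> norm_num
  -- Since x·x = d and x·v_i = d/2, v_i·v_j equals (x - v_i)·(x - v_j), which is at least 4 because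
  -- of the chosen column. This rules out 0 and -d/2.
  have hgram : ∀ i j, i ≠ j → v i ⬝ᵥ v j = d / 2 := fun i j hij => by
    have hcol : ∀ i, v i ⟨0, hd⟩ * x ⟨0, hd⟩ = -1 := fun i => by
      rw [← hc i]
      simp only [v, Pi.smul_apply, smul_eq_mul, mul_assoc, hxdef]
    have hpos : (x ⟨0, hd⟩ - v i ⟨0, hd⟩) * (x ⟨0, hd⟩ - v j ⟨0, hd⟩) ≤
        (x - v i) ⬝ᵥ (x - v j) :=
      Finset.single_le_sum (f := fun k => (x k - v i k) * (x k - v j k))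
        (fun k _ => hterm i j k) (Finset.mem_univ _)
    have hneg : ∀ i, v i ⟨0, hd⟩ = -x ⟨0, hd⟩ := fun i => by
      linear_combination x ⟨0, hd⟩ * hcol i - v i ⟨0, hd⟩ * hxsq ⟨0, hd⟩
    rw [hneg, hneg, sub_dotProduct, dotProduct_sub, dotProduct_sub, hxx, hxv,
      dotProduct_comm (v i) x, hxv] at hpos
    have hsq : (v i ⬝ᵥ v j) ^ 2 = 0 ∨ (v i ⬝ᵥ v j) ^ 2 = a := by
      have h : v i ⬝ᵥ v j = ε i * (ε j * (H i.succ * (H j.succ)ᵀ) (r' i) (r' j)) := by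
        rw [smul_dotProduct, dotProduct_smul]
        rfl
      rw [h, mul_pow, mul_pow, hε, hε, one_mul, one_mul]
      exact (hH.2 _ _ fun h => hij (Fin.succ_injective _ h)).sq_mul_transpose_apply ha _ _
    have hx0 := hxsq ⟨0, hd⟩
    have hpos' : 0 < v i ⬝ᵥ v j := by nlinarith
    rcases hsq with h | h
    · exact absurd (pow_eq_zero_iff two_ne_zero |>.1 h) hpos'.ne'
    · have hfac : (v i ⬝ᵥ v j - d / 2) * (v i ⬝ᵥ v j + d / 2) = 0 := by
        linear_combination h + had' / 4
      rcases mul_eq_zero.1 hfac with h' | h'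
      · exact sub_eq_zero.1 h'
      · linarith
  have hli : LinearIndependent ℝ v :=
    linearIndependent_of_dotProduct_eq (m := d / 2) (by positivity)
      (fun i => by rw [hvv]; ring) hgram
  have := hli.fintype_card_le_finrank
  simp at this
  omega

end MutuallyQuasiUnbiased

/-! ### From inequalities to the table -/

/-- A bound on the sizes of all families bounds the maximum, which then exists. -/
theorem exists_isMaxQuasiUnbiased {d l a : ℕ} (B : ℕ)
    (hB : ∀ (n : ℕ) (H : Fin n → Matrix (Fin d) (Fin d) ℝ), MutuallyQuasiUnbiased d l a H →
      n ≤ B) : ∃ f, IsMaxQuasiUnbiased d l a f ∧ f ≤ B := by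
  have hub : ∀ n ∈ {n : ℕ | ∃ H : Fin n → Matrix (Fin d) (Fin d) ℝ,
      MutuallyQuasiUnbiased d l a H}, n ≤ B := fun n ⟨H, hH⟩ => hB n H hH
  have hne : {n : ℕ | ∃ H : Fin n → Matrix (Fin d) (Fin d) ℝ,
      MutuallyQuasiUnbiased d l a H}.Nonempty :=
    -- The empty family qualifies vacuously.
    ⟨0, fun i => i.elim0, fun i => i.elim0, fun i => i.elim0⟩
  have hmem := Nat.sSup_mem hne ⟨B, hub⟩
  exact ⟨_, ⟨hmem, fun n hn => le_csSup ⟨B, hub⟩ hn⟩, hub _ hmem⟩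

theorem le_of_pos_mul_linear {f d B : ℕ} (hd : 0 < d) {P Q : ℝ}
    (hQ : Q ≤ 0) (hPQ : P + B * Q < 0) (h : 0 ≤ f * d * (P + (f - 1) * Q)) : f ≤ B := by
  by_contra! hlt
  have hf : (B : ℝ) + 1 ≤ f := by exact_mod_cast hlt
  have hpos : (0 : ℝ) < f * d :=
    mul_pos (by linarith [Nat.cast_nonneg (α := ℝ) B]) (Nat.cast_pos.2 hd)
  have := nonneg_of_mul_nonneg_right h hpos
  nlinarith

theorem le_of_degree_six {d l a B f : ℕ} {H : Fin f → Matrix (Fin d) (Fin d) ℝ}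
    (hH : MutuallyQuasiUnbiased d l a H) (ha : 0 < a) (hd : 0 < d)
    (hneg : ∀ g : ℝ → ℝ, (∀ q, g q = q ^ 3 - (15 * d - 40) * q ^ 2
        + (45 * (d : ℝ) ^ 2 - 210 * d + 184) * q
        - 15 * (d : ℝ) ^ 3 + 90 * (d : ℝ) ^ 2 - 120 * d) →
      d * g 0 + l * (g a - g 0) ≤ 0 ∧
      g ((d : ℝ) ^ 2) + (d - 1) * g 0 + B * (d * g 0 + l * (g a - g 0)) < 0) : f ≤ B :=
  le_of_pos_mul_linear hd (hneg _ fun _ => rfl).1 (hneg _ fun _ => rfl).2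
    (hH.degree_six_inequality ha _ fun _ => rfl)

theorem le_of_degree_four {d l a B f : ℕ} {H : Fin f → Matrix (Fin d) (Fin d) ℝ}
    (hH : MutuallyQuasiUnbiased d l a H) (ha : 0 < a) (hd : 0 < d)
    (hneg : ∀ g : ℝ → ℝ, (∀ q, g q = q ^ 2 - (6 * d - 8) * q + 3 * (d : ℝ) ^ 2 - 6 * d) →
      d * g 0 + l * (g a - g 0) ≤ 0 ∧
      g ((d : ℝ) ^ 2) + (d - 1) * g 0 + B * (d * g 0 + l * (g a - g 0)) < 0) : f ≤ B :=
  le_of_pos_mul_linear hd (hneg _ fun _ => rfl).1 (hneg _ fun _ => rfl).2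
    (hH.degree_four_inequality ha _ fun _ => rfl)

/-- For each parameter triple the maximum number `f` of mutually quasi-unbiased Hadamard matrices
exists and satisfies every bound in its row of the table (columns from left to right, blank entries
omitted). -/
theorem mainTheorem8 :
    (∃ f, IsMaxQuasiUnbiased 16 4 64 f ∧ f ≤ 35 ∧ f ≤ 15 ∧ f ≤ 15) ∧
    (∃ f, IsMaxQuasiUnbiased 24 4 144 f ∧ f ≤ 85 ∧ f ≤ 27 ∧ f ≤ 25) ∧
    (∃ f, IsMaxQuasiUnbiased 24 9 64 f ∧ f ≤ 85 ∧ f ≤ 208 ∧ f ≤ 95) ∧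
    (∃ f, IsMaxQuasiUnbiased 32 4 256 f ∧ f ≤ 155 ∧ f ≤ 63 ∧ f ≤ 47) ∧
    (∃ f, IsMaxQuasiUnbiased 36 9 144 f ∧ f ≤ 199 ∧ f ≤ 80 ∧ f ≤ 79) ∧
    (∃ f, IsMaxQuasiUnbiased 40 4 400 f ∧ f ≤ 247 ∧ f ≤ 101) ∧
    (∃ f, IsMaxQuasiUnbiased 40 25 64 f ∧ f ≤ 28 ∧ f ≤ 30 ∧ f ≤ 30) ∧
    (∃ f, IsMaxQuasiUnbiased 48 4 576 f ∧ f ≤ 361 ∧ f ≤ 276) ∧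
    (∃ f, IsMaxQuasiUnbiased 48 9 256 f ∧ f ≤ 361 ∧ f ≤ 105 ∧ f ≤ 104) ∧
    (∃ f, IsMaxQuasiUnbiased 48 16 144 f ∧ f ≤ 361 ∧ f ≤ 316) ∧
    (∃ f, IsMaxQuasiUnbiased 48 36 64 f ∧ f ≤ 28 ∧ f ≤ 30 ∧ f ≤ 30) := by
  -- Each bound used is the smallest number in its row of the table.
  have h_16_4 := exists_isMaxQuasiUnbiased (d := 16) (l := 4) (a := 64) 15 fun n H hH =>
      le_of_degree_six hH (by norm_num) (by norm_num) fun g hg => by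
        simp only [hg]; norm_num
  have h_24_4 := exists_isMaxQuasiUnbiased (d := 24) (l := 4) (a := 144) 25 fun n H hH =>
      le_of_degree_six hH (by norm_num) (by norm_num) fun g hg => by
        simp only [hg]; norm_num
  have h_24_9 := exists_isMaxQuasiUnbiased (d := 24) (l := 9) (a := 64) 85 fun n H hH =>
      le_of_degree_six hH (by norm_num) (by norm_num) fun g hg => by
        simp only [hg]; norm_num
  have h_32_4 := exists_isMaxQuasiUnbiased (d := 32) (l := 4) (a := 256) 47 fun n H hH =>
      le_of_degree_six hH (by norm_num) (by norm_num) fun g hg => by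
        simp only [hg]; norm_num
  have h_36_9 := exists_isMaxQuasiUnbiased (d := 36) (l := 9) (a := 144) 79 fun n H hH =>
      le_of_degree_six hH (by norm_num) (by norm_num) fun g hg => by
        simp only [hg]; norm_num
  have h_40_4 := exists_isMaxQuasiUnbiased (d := 40) (l := 4) (a := 400) 101 fun n H hH =>
      le_of_degree_six hH (by norm_num) (by norm_num) fun g hg => by
        simp only [hg]; norm_num
  have h_40_25 := exists_isMaxQuasiUnbiased (d := 40) (l := 25) (a := 64) 28 fun n H hH =>
      le_of_degree_four hH (by norm_num) (by norm_num) fun g hg => by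
        simp only [hg]; norm_num
  -- The 60° argument gives 49, well below 276.
  have h_48_4 := exists_isMaxQuasiUnbiased (d := 48) (l := 4) (a := 576) 276 fun n H hH =>
      (hH.le_order_add_one_of_weight_four (by norm_num) (by norm_num)).trans (by norm_num)
  have h_48_9 := exists_isMaxQuasiUnbiased (d := 48) (l := 9) (a := 256) 104 fun n H hH =>
      le_of_degree_six hH (by norm_num) (by norm_num) fun g hg => by
        simp only [hg]; norm_num
  have h_48_16 := exists_isMaxQuasiUnbiased (d := 48) (l := 16) (a := 144) 316 fun n H hH =>
      le_of_degree_six hH (by norm_num) (by norm_num) fun g hg => by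
        simp only [hg]; norm_num
  have h_48_36 := exists_isMaxQuasiUnbiased (d := 48) (l := 36) (a := 64) 28 fun n H hH =>
      le_of_degree_four hH (by norm_num) (by norm_num) fun g hg => by
        simp only [hg]; norm_num
  refine ⟨?_, ?_, ?_, ?_, ?_, ?_, ?_, ?_, ?_, ?_, ?_⟩
  · obtain ⟨f, hf, hb⟩ := h_16_4
    exact ⟨f, hf, by omega⟩
  · obtain ⟨f, hf, hb⟩ := h_24_4
    exact ⟨f, hf, by omega⟩
  · obtain ⟨f, hf, hb⟩ := h_24_9
    exact ⟨f, hf, by omega⟩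
  · obtain ⟨f, hf, hb⟩ := h_32_4
    exact ⟨f, hf, by omega⟩
  · obtain ⟨f, hf, hb⟩ := h_36_9
    exact ⟨f, hf, by omega⟩
  · obtain ⟨f, hf, hb⟩ := h_40_4
    exact ⟨f, hf, by omega⟩
  · obtain ⟨f, hf, hb⟩ := h_40_25
    exact ⟨f, hf, by omega⟩
  · obtain ⟨f, hf, hb⟩ := h_48_4
    exact ⟨f, hf, by omega⟩
  · obtain ⟨f, hf, hb⟩ := h_48_9
    exact ⟨f, hf, by omega⟩
  · obtain ⟨f, hf, hb⟩ := h_48_16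
    exact ⟨f, hf, by omega⟩
  · obtain ⟨f, hf, hb⟩ := h_48_36
    exact ⟨f, hf, by omega⟩
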